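/- \textbf{Setting.} Let $\mathsf X$ be a countably infinite set of variables. The terms of $\Lambda_\oplus$, taken up to renaming of bound variables, are $$M,N ::= x \mid \lambda x.M \mid M\,N \mid M\oplus N .$$ For a finite $\overline x\subseteq\mathsf X$, let $\Lambda_\oplus(\overline x)$ be the set of terms whose free variables lie in $\overline x$; closed terms are the elements of $\Lambda_\oplus(\emptyset)$, and values are closed abstractions. \textbf{Call-by-name semantics.} The approximation judgments $M\Downarrow\mathscr D$, with $\mathscr D$ a finitely supported subprobability distribution on values, are generated by the rules: $M\Downarrow\emptyset$; $V\Downarrow\{V\}$ for a value $V$; if $M\Downarrow\mathscr D$ and $P\{N/x\}\Downarrow\mathscr E_{P}$ for every $\lambda x.P$ in the support of $\mathscr D$, then $M\,N\Downarrow\sum_{\lambda x.P}\mathscr D(\lambda x.P)\cdot\mathscr E_{P}$; if $M\Downarrow\mathscr D$ and $N\Downarrow\mathscr E$, then $M\oplus N\Downarrow\frac12\mathscr D+\frac12\mathscr E$. The semantics of a closed term $M$ is the pointwise supremum $[\![M]\!]=\sup_{M\Downarrow\mathscr D}\mathscr D$, and the convergence probability of $M$ is $\sum_V[\![M]\!](V)$,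 the sum being over all values. \textbf{Applicative bisimilarity.} Consider the labelled Markov chain whose states are the closed terms together with a disjoint copy of the values (the distinguished values $\nu x.N$), whose labels are $\tau$ and the closed terms, and whose transition probabilities are $\mathcal P(M,\tau,\nu x.N)=[\![M]\!](\lambda x.N)$, $\mathcal P(\nu x.N,L,N\{L/x\})=1$, and $0$ in all other cases. A probabilistic applicative bisimulation is an equivalence relation $\mathcal R$ on states, relating only closed terms to closed terms and distinguished values to distinguished values, such that $s\,\mathcal R\,t$ implies $\sum_{u\in E}\mathcal P(s,\ell,u)=\sum_{u\in E}\mathcal P(t,\ell,u)$ for every label $\ell$ and every equivalence class $E$ of $\mathcal R$. Probabilistic applicative bisimilarity $\sim$ is the union of all such relations. For $M,N\in\Lambda_\oplus(\overline x)$, write $\overline x\vdash M\sim N$ if $M\sigma\sim N\sigma$ for every substitution $\sigma$ of closed terms for the variables. \textbf{Context equivalence.} Contexts with exactly one hole are generated by $C::=[\cdot]\mid\lambda x.C\mid C\,M\mid M\,C\mid C\oplus M\mid M\oplus C$, and $C[M]$ is the term obtained by filling the hole with $M$, where binders of $C$ may capture free variables of $M$. The sets $\mathsf C(\overline x;\overline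 y)$ of contexts are defined inductively: $[\cdot]\in\mathsf C(\overline x;\overline x)$; $\lambda x.C\in\mathsf C(\overline x;\overline y)$ if $x\notin\overline y$ and $C\in\mathsf C(\overline x;\overline y\cup\{x\})$; and $C\,M,\ M\,C,\ C\oplus M,\ M\oplus C\in\mathsf C(\overline x;\overline y)$ if $C\in\mathsf C(\overline x;\overline y)$ and $M\in\Lambda_\oplus(\overline y)$. For $M,N\in\Lambda_\oplus(\overline x)$, write $\overline x\vdash M\leq_\oplus N$ if for every $C\in\mathsf C(\overline x;\emptyset)$ the convergence probability of $C[M]$ is at most that of $C[N]$, and $\overline x\vdash M\simeq_\oplus N$ (probabilistic context equivalence) if $\overline x\vdash M\leq_\oplus N$ and $\overline x\vdash N\leq_\oplus M$. \textbf{Theorem.} For every finite $\overline x\subseteq\mathsf X$ and all $M,N\in\Lambda_\oplus(\overline x)$, if $\overline x\vdash M\sim N$ then $\overline x\vdash M\simeq_\oplus N$. -/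

import Mathlib

open scoped ENNReal

noncomputable section

namespace LambdaOplus

/-! ## Terms

The set of variable names is `ℕ`. Terms modulo renaming of bound variables are represented by
de Bruijn terms: under `k` binders the index `i < k` is bound, and the index `i + k` is the free
variable named `i`. Distinct de Bruijn terms are distinct α-equivalence classes. -/

/-- Term expressions of the probabilistic λ-calculus. -/
inductive Term : Type
  | var (i : ℕ) : Term
  | lam (P : Term) : Term
  | app (M N : Term) : Term
  | choice (M N : Term) : Term
  deriving Countable

namespace Term

/-- The set of free variables. -/
def FV : Term → Set ℕ
  | var i => {i}
  | lam P => {i | i + 1 ∈ FV P}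
  | app M N => FV M ∪ FV N
  | choice M N => FV M ∪ FV N

/-- Lift a renaming under a binder. -/
def liftRen (ρ : ℕ → ℕ) : ℕ → ℕ
  | 0 => 0
  | i + 1 => ρ i + 1

/-- Capture-avoiding renaming of the free variables. -/
def rename : Term → (ℕ → ℕ) → Term
  | var i, ρ => var (ρ i)
  | lam P, ρ => lam (P.rename (liftRen ρ))
  | app M N, ρ => app (M.rename ρ) (N.rename ρ)
  | choice M N, ρ => choice (M.rename ρ) (N.rename ρ)

/-- Lift a substitution under a binder. -/
def liftSub (σ : ℕ → Term) : ℕ → Term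
  | 0 => var 0
  | i + 1 => (σ i).rename Nat.succ

/-- Capture-avoiding simultaneous substitution for the free variables. -/
def subst : Term → (ℕ → Term) → Term
  | var i, σ => σ i
  | lam P, σ => lam (P.subst (liftSub σ))
  | app M N, σ => app (M.subst σ) (N.subst σ)
  | choice M N, σ => choice (M.subst σ) (N.subst σ)

/-- The capture-avoiding substitution `M{N/x}` of `N` for the free variable named `x`. -/
def subst1 (M : Term) (x : ℕ) (N : Term) : Term :=
  M.subst (fun y => if y = x then N else var y)

/-- The abstraction `λx.M` of the free variable named `x` in `M`. -/
def abs (x : ℕ) (M : Term) : Term :=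
  lam (M.rename (fun y => if y = x then 0 else y + 1))

/-- The result of replacing the variable bound by the outermost binder of `lam P` by `N`. -/
def inst (P N : Term) : Term :=
  P.subst (fun i => Nat.casesOn i N var)

theorem mem_FV_rename (M : Term) : ∀ (ρ : ℕ → ℕ) (i : ℕ),
    i ∈ (M.rename ρ).FV ↔ ∃ j ∈ M.FV, ρ j = i := by
  induction M with
  | var j => intro ρ i; simp [rename, FV, eq_comm]
  | lam P ih =>
    intro ρ i
    simp only [rename, FV, Set.mem_ofPred_eq, ih]
    constructor
    · rintro ⟨j, hj, h⟩
      cases j with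
      | zero => simp [liftRen] at h
      | succ j => exact ⟨j, hj, by simpa [liftRen] using h⟩
    · rintro ⟨j, hj, h⟩
      exact ⟨j + 1, hj, by simpa [liftRen] using h⟩
  | app M N ihM ihN =>
    intro ρ i; simp only [rename, FV, Set.mem_union, ihM, ihN]; grind
  | choice M N ihM ihN =>
    intro ρ i; simp only [rename, FV, Set.mem_union, ihM, ihN]; grind

theorem mem_FV_subst (M : Term) : ∀ (σ : ℕ → Term) (i : ℕ),
    i ∈ (M.subst σ).FV → ∃ j ∈ M.FV, i ∈ (σ j).FV := by
  induction M with
  | var j => intro σ i h; exact ⟨j, rfl, h⟩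
  | lam P ih =>
    intro σ i h
    obtain ⟨j, hj, h⟩ := ih _ _ h
    cases j with
    | zero => simp [liftSub, FV] at h
    | succ j =>
      obtain ⟨k, hk, e⟩ := (mem_FV_rename _ _ _).1 h
      obtain rfl : k = i := by simpa using e
      exact ⟨j, hj, hk⟩
  | app M N ihM ihN =>
    rintro σ i (h | h)
    · obtain ⟨j, hj, h⟩ := ihM _ _ h; exact ⟨j, Or.inl hj, h⟩
    · obtain ⟨j, hj, h⟩ := ihN _ _ h; exact ⟨j, Or.inr hj, h⟩
  | choice M N ihM ihN =>
    rintro σ i (h | h)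
    · obtain ⟨j, hj, h⟩ := ihM _ _ h; exact ⟨j, Or.inl hj, h⟩
    · obtain ⟨j, hj, h⟩ := ihN _ _ h; exact ⟨j, Or.inr hj, h⟩

/-- Free variables of `λx.M`. -/
theorem FV_abs (x : ℕ) (M : Term) : (abs x M).FV = M.FV \ {x} := by
  ext i
  simp only [abs, FV, Set.mem_ofPred_eq, mem_FV_rename, Set.mem_sdiff, Set.mem_singleton_iff]
  constructor
  · rintro ⟨j, hj, h⟩
    split_ifs at h with e
    obtain rfl : j = i := by omega
    exact ⟨hj, e⟩
  · rintro ⟨hi, e⟩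
    exact ⟨i, hi, by simp [e]⟩

theorem subst_rename (M : Term) : ∀ (ρ : ℕ → ℕ) (σ : ℕ → Term),
    (M.rename ρ).subst σ = M.subst (fun i => σ (ρ i)) := by
  induction M with
  | var j => intro ρ σ; rfl
  | lam P ih =>
    intro ρ σ
    simp only [rename, subst, ih]
    congr 2
    funext i
    cases i <;> rfl
  | app M N ihM ihN => intro ρ σ; simp only [rename, subst, ihM, ihN]
  | choice M N ihM ihN => intro ρ σ; simp only [rename, subst, ihM, ihN]

/-- Instantiating the bound variable of `λx.M` by `N` yields `M{N/x}`. -/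
theorem inst_abs (x : ℕ) (M N : Term) :
    inst (M.rename (fun y => if y = x then 0 else y + 1)) N = M.subst1 x N := by
  rw [inst, subst_rename, subst1]
  congr 1
  funext y
  by_cases h : y = x <;> simp [h]

end Term

/-- The terms whose free variables are among the finite set `X`. -/
def TermOver (X : Finset ℕ) : Type := {M : Term // M.FV ⊆ (X : Set ℕ)}

/-- Closed terms. -/
abbrev ClosedTerm : Type := TermOver ∅

/-- Apply a closing substitution, which maps every variable to a closed term. -/
def TermOver.close {X : Finset ℕ} (M : TermOver X) (σ : ℕ → ClosedTerm) : ClosedTerm :=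
  ⟨M.1.subst (fun i => (σ i).1), by
    intro i hi
    obtain ⟨j, -, h⟩ := Term.mem_FV_subst _ _ _ hi
    exact (σ j).2 h⟩

/-- A value is a closed abstraction `lam body`. -/
@[ext]
structure Value : Type where
  body : Term
  closed : (Term.lam body).FV = ∅

/-- A value, seen as a term. -/
def Value.toTerm (V : Value) : Term := Term.lam V.body

/-- For a value `λx.N` and a closed term `L`, the closed term `N{L/x}`. -/
def Value.apply (V : Value) (L : ClosedTerm) : ClosedTerm :=
  ⟨V.body.inst L.1, by
    intro i hi
    obtain ⟨j, hj, h⟩ := Term.mem_FV_subst _ _ _ hi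
    cases j with
    | zero => exact L.2 h
    | succ j =>
      have : j ∈ (Term.lam V.body).FV := hj
      simp [V.closed] at this⟩

instance (X : Finset ℕ) : Countable (TermOver X) :=
  inferInstanceAs (Countable {M : Term // M.FV ⊆ (X : Set ℕ)})

instance : Countable Value :=
  Function.Injective.countable (f := Value.body) (fun _ _ h => Value.ext h)

/-! ## Call-by-name semantics -/

open Classical in
/-- Big-step approximation semantics. In the rule for application, only the values in the
support of `D` contribute to the sum, and a premise is required for exactly these values.
All the distributions that are derived have finite support. -/
inductive BigStep : Term → (Value → ℝ≥0∞) → Prop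
  | bt (M : Term) : BigStep M 0
  | bv (V : Value) : BigStep V.toTerm (Pi.single V 1)
  | ba {M N : Term} {D : Value → ℝ≥0∞} {E : Value → Value → ℝ≥0∞} :
      BigStep M D → (∀ V, D V ≠ 0 → BigStep (V.body.inst N) (E V)) →
      BigStep (Term.app M N) (fun W => ∑' V, D V * E V W)
  | bs {M N : Term} {D E : Value → ℝ≥0∞} :
      BigStep M D → BigStep N E →
      BigStep (Term.choice M N) (fun W => 2⁻¹ * D W + 2⁻¹ * E W)

/-- The semantics of a (closed) term: the pointwise supremum of its finite approximations. -/
def sem (M : Term) : Value → ℝ≥0∞ := sSup {D | BigStep M D}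

/-- `M` converges with probability `p`: the semantics of `M` has total mass `p`. -/
def ConvergesWith (M : Term) (p : ℝ≥0∞) : Prop := ∑' V, sem M V = p

theorem BigStep.tsum_le_one {M : Term} {D : Value → ℝ≥0∞} (h : BigStep M D) :
    ∑' V, D V ≤ 1 := by
  induction h with
  | bt M => simp
  | bv V => simp [tsum_pi_single]
  | @ba M N D E _ _ ihD ihE =>
    rw [ENNReal.tsum_comm]
    refine le_trans (ENNReal.tsum_le_tsum fun V => ?_) ihD
    rw [ENNReal.tsum_mul_left]
    by_cases hV : D V = 0
    · simp [hV]
    · exact mul_le_of_le_one_right' (ihE V hV)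
  | bs _ _ ihD ihE =>
    rw [ENNReal.tsum_add, ENNReal.tsum_mul_left, ENNReal.tsum_mul_left]
    calc _ ≤ (2⁻¹ : ℝ≥0∞) * 1 + 2⁻¹ * 1 := by gcongr
      _ = 1 := by simp [ENNReal.inv_two_add_inv_two]

theorem BigStep.directed {M : Term} {D : Value → ℝ≥0∞} (h : BigStep M D) :
    ∀ {D' : Value → ℝ≥0∞}, BigStep M D' → ∃ F, BigStep M F ∧ D ≤ F ∧ D' ≤ F := by
  induction h with
  | bt M => intro D' h'; exact ⟨D', h', fun _ => zero_le, le_rfl⟩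
  | bv V =>
    intro D' h'
    generalize hT : V.toTerm = T at h'
    cases h' with
    | bt M => subst hT; exact ⟨_, .bv V, le_rfl, fun _ => zero_le⟩
    | bv V' =>
      obtain rfl : V = V' := Value.ext (by simpa [Value.toTerm] using hT)
      exact ⟨_, .bv V, le_rfl, le_rfl⟩
    | ba _ _ => simp [Value.toTerm] at hT
    | bs _ _ => simp [Value.toTerm] at hT
  | @ba M N D E hD hE ihD ihE =>
    intro D' h'
    cases h' with
    | bt M => exact ⟨_, .ba hD hE, le_rfl, fun _ => zero_le⟩
    | @ba _ _ D₂ E₂ hD₂ hE₂ =>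
      obtain ⟨F, hF, h1, h2⟩ := ihD hD₂
      have key : ∀ V, ∃ G, BigStep (V.body.inst N) G ∧
          (D V ≠ 0 → E V ≤ G) ∧ (D₂ V ≠ 0 → E₂ V ≤ G) := by
        intro V
        by_cases a : D V = 0
        · by_cases b : D₂ V = 0
          · exact ⟨0, .bt _, fun c => absurd a c, fun c => absurd b c⟩
          · exact ⟨E₂ V, hE₂ V b, fun c => absurd a c, fun _ => le_rfl⟩
        · by_cases b : D₂ V = 0
          · exact ⟨E V, hE V a, fun _ => le_rfl, fun c => absurd b c⟩
          · obtain ⟨G, hG, g1, g2⟩ := ihE V a (hE₂ V b)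
            exact ⟨G, hG, fun _ => g1, fun _ => g2⟩
      choose G hG g1 g2 using key
      refine ⟨_, .ba hF (fun V _ => hG V), fun W => ENNReal.tsum_le_tsum fun V => ?_,
        fun W => ENNReal.tsum_le_tsum fun V => ?_⟩
      · by_cases a : D V = 0
        · simp [a]
        · exact mul_le_mul' (h1 V) (g1 V a W)
      · by_cases a : D₂ V = 0
        · simp [a]
        · exact mul_le_mul' (h2 V) (g2 V a W)
  | @bs M N D E hD hE ihD ihE =>
    intro D' h'
    cases h' with
    | bt M => exact ⟨_, .bs hD hE, le_rfl, fun _ => zero_le⟩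
    | bs hD₂ hE₂ =>
      obtain ⟨F, hF, f1, f2⟩ := ihD hD₂
      obtain ⟨G, hG, g1, g2⟩ := ihE hE₂
      refine ⟨_, .bs hF hG, fun W => ?_, fun W => ?_⟩
      · exact add_le_add (mul_le_mul' le_rfl (f1 W)) (mul_le_mul' le_rfl (g1 W))
      · exact add_le_add (mul_le_mul' le_rfl (f2 W)) (mul_le_mul' le_rfl (g2 W))

theorem tsum_sem_le_one (M : Term) : ∑' V, sem M V ≤ 1 := by
  rw [ENNReal.tsum_eq_iSup_sum]
  refine iSup_le fun s => ?_
  have h : ∀ V, sem M V = ⨆ D : {D // BigStep M D}, D.1 V := fun V => by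
    rw [sem, sSup_apply]; rfl
  simp only [h]
  rw [ENNReal.finsetSum_iSup (fun D D' => ?_)]
  · exact iSup_le fun D => (ENNReal.sum_le_tsum s).trans D.2.tsum_le_one
  · obtain ⟨F, hF, h1, h2⟩ := D.2.directed D'.2
    exact ⟨⟨F, hF⟩, fun V => ⟨h1 V, h2 V⟩⟩

/-! ## Labelled Markov chains and probabilistic bisimilarity -/

/-- A labelled Markov chain with a countable set `S` of states and a set `L` of labels. -/
structure LabelledMarkovChain (S L : Type) [Countable S] where
  prob : S → L → S → ℝ≥0∞
  tsum_prob_le_one : ∀ ℓ s, ∑' t, prob s ℓ t ≤ 1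

/-- The probability of moving from `s` with label `ℓ` to a state in `A`. -/
def LabelledMarkovChain.probSet {S L : Type} [Countable S] (C : LabelledMarkovChain S L)
    (s : S) (ℓ : L) (A : Set S) : ℝ≥0∞ := ∑' t : A, C.prob s ℓ t

/-- An equivalence relation is a probabilistic bisimulation if related states have, for every
label, the same probability of reaching each equivalence class. -/
def LabelledMarkovChain.IsBisimulation {S L : Type} [Countable S] (C : LabelledMarkovChain S L)
    (R : Setoid S) : Prop :=
  ∀ s t, R s t → ∀ ℓ, ∀ E ∈ R.classes, C.probSet s ℓ E = C.probSet t ℓ E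

/-- States: closed terms, and a disjoint copy of the values (the distinguished values). -/
abbrev State : Type := ClosedTerm ⊕ Value

/-- Labels: closed terms (parameter passing), and `τ = Sum.inr ()` (evaluation). -/
abbrev Label : Type := ClosedTerm ⊕ Unit

open Classical in
/-- The transition probability matrix: a closed term evaluates under `τ` to a distinguished value
according to its semantics, and a distinguished value `λx.N` moves with probability `1`
under the label `L` to `N{L/x}`. -/
def trans : State → Label → State → ℝ≥0∞
  | Sum.inl M, Sum.inr _, Sum.inr V => sem M.1 V
  | Sum.inr V, Sum.inl L, Sum.inl P => if P = V.apply L then 1 else 0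
  | _, _, _ => 0

theorem tsum_trans_le_one (ℓ : Label) (s : State) : ∑' t, trans s ℓ t ≤ 1 := by
  rw [Summable.tsum_sum ENNReal.summable ENNReal.summable]
  rcases s with M | V <;> rcases ℓ with L | u
  · simp [trans]
  · simpa [trans] using tsum_sem_le_one M.1
  · simp [trans, tsum_ite_eq]
  · simp [trans]

/-- The calculus as a multisorted labelled Markov chain. -/
def chain : LabelledMarkovChain State Label where
  prob := trans
  tsum_prob_le_one := tsum_trans_le_one

/-- A probabilistic applicative bisimulation: a probabilistic bisimulation on the multisorted
chain, hence one that relates only states of the same sort. -/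
def IsPAB (R : Setoid State) : Prop :=
  chain.IsBisimulation R ∧ ∀ s t, R s t → s.isLeft = t.isLeft

/-- Probabilistic applicative bisimilarity: the union of all such bisimulations. -/
def Bisimilar (s t : State) : Prop := ∃ R : Setoid State, IsPAB R ∧ R s t

/-- Probabilistic applicative bisimilarity on terms with free variables in `X`: bisimilarity of
the closed terms obtained from every closing substitution. -/
def OpenBisimilar (X : Finset ℕ) (M N : TermOver X) : Prop :=
  ∀ σ : ℕ → ClosedTerm, Bisimilar (Sum.inl (M.close σ)) (Sum.inl (N.close σ))

/-! ## Contexts and context equivalence -/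

/-- Term contexts with exactly one hole. Binders carry names, since they may capture. -/
inductive Ctx : Type
  | hole : Ctx
  | lam (x : ℕ) (C : Ctx) : Ctx
  | appL (C : Ctx) (M : Term) : Ctx
  | appR (M : Term) (C : Ctx) : Ctx
  | choiceL (C : Ctx) (M : Term) : Ctx
  | choiceR (M : Term) (C : Ctx) : Ctx

/-- Fill the hole, possibly capturing free variables. -/
def Ctx.fill : Ctx → Term → Term
  | .hole, N => N
  | .lam x C, N => Term.abs x (C.fill N)
  | .appL C M, N => Term.app (C.fill N) M
  | .appR M C, N => Term.app M (C.fill N)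
  | .choiceL C M, N => Term.choice (C.fill N) M
  | .choiceR M C, N => Term.choice M (C.fill N)

/-- `CtxOver C X Y`: the context `C` turns terms with free variables in `X` into terms with free
variables in `Y`. -/
inductive CtxOver : Ctx → Finset ℕ → Finset ℕ → Prop
  | hole (X : Finset ℕ) : CtxOver .hole X X
  | lam {C : Ctx} {X Y : Finset ℕ} {x : ℕ} :
      CtxOver C X (Y ∪ {x}) → x ∉ Y → CtxOver (.lam x C) X Y
  | appL {C : Ctx} {X Y : Finset ℕ} (M : TermOver Y) :
      CtxOver C X Y → CtxOver (.appL C M.1) X Y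
  | appR {C : Ctx} {X Y : Finset ℕ} (M : TermOver Y) :
      CtxOver C X Y → CtxOver (.appR M.1 C) X Y
  | choiceL {C : Ctx} {X Y : Finset ℕ} (M : TermOver Y) :
      CtxOver C X Y → CtxOver (.choiceL C M.1) X Y
  | choiceR {C : Ctx} {X Y : Finset ℕ} (M : TermOver Y) :
      CtxOver C X Y → CtxOver (.choiceR M.1 C) X Y

/-- The probabilistic context preorder. -/
def CtxPreorder (X : Finset ℕ) (M N : TermOver X) : Prop :=
  ∀ C : Ctx, CtxOver C X ∅ → ∀ p, ConvergesWith (C.fill M.1) p →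
    ∃ q, ConvergesWith (C.fill N.1) q ∧ p ≤ q

/-- Probabilistic context equivalence. -/
def CtxEquiv (X : Finset ℕ) (M N : TermOver X) : Prop :=
  CtxPreorder X M N ∧ CtxPreorder X N M

end LambdaOplus

end

/-! The proof is Howe's method, applied to applicative similarity. Bisimilarity is contained in
similarity because the image of any set under a bisimulation is a union of classes
(`Bisimilar.similar`). Bisimilarity is symmetric, so it suffices to show that similarity implies the
context preorder and then to use this in both directions.

Howe's closure contains open similarity, is respected by all term constructors and hence by contexts
(`Howe.fill`), and is stable under simultaneous substitution (`Howe.subst`). What remains is that it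
does not decrease convergence probability on closed terms. For this, `BigStep.mass_le_of_howe` shows
by induction on approximations that the mass of a set `A` of values is bounded by the mass, on the
other side, of the image of `A` under the closure.

The probabilistic difficulty is application, where related distributions on functions are followed
by related continuations. The first hypothesis compares masses of sets; the conclusion compares
expectations. The layer-cake formula passes from one to the other (`tsum_mul_le_tsum_mul_of_rel`),
with no need to split the masses into a coupling. -/

namespace LambdaOplus

/-! ### Substitution calculus and closed terms -/

namespace Term

theorem subst_congr (M : Term) : ∀ {σ τ : ℕ → Term}, (∀ i ∈ M.FV, σ i = τ i) →
    M.subst σ = M.subst τ := by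
  induction M with
  | var i => intro σ τ h; exact h i rfl
  | lam P ih =>
    intro σ τ h
    simp only [subst]
    congr 1
    refine ih fun i hi => ?_
    cases i with
    | zero => rfl
    | succ i => simp only [liftSub]; rw [h i hi]
  | app M N ihM ihN =>
    intro σ τ h
    simp only [subst]
    rw [ihM fun i hi => h i (Or.inl hi), ihN fun i hi => h i (Or.inr hi)]
  | choice M N ihM ihN =>
    intro σ τ h
    simp only [subst]
    rw [ihM fun i hi => h i (Or.inl hi), ihN fun i hi => h i (Or.inr hi)]

theorem liftSub_var : liftSub var = var := by
  funext i
  cases i <;> rfl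

theorem subst_var (M : Term) : M.subst var = M := by
  induction M with
  | var i => rfl
  | lam P ih => simp only [subst, liftSub_var, ih]
  | app M N ihM ihN => simp only [subst, ihM, ihN]
  | choice M N ihM ihN => simp only [subst, ihM, ihN]

theorem subst_of_closed {M : Term} (h : M.FV = ∅) (σ : ℕ → Term) : M.subst σ = M := by
  conv_rhs => rw [← subst_var M]
  exact subst_congr M fun i hi => by simp [h] at hi

theorem rename_eq_subst (M : Term) : ∀ ρ : ℕ → ℕ, M.rename ρ = M.subst (fun i => var (ρ i)) := by
  induction M with
  | var i => intro ρ; rfl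
  | lam P ih =>
    intro ρ
    simp only [rename, subst, ih]
    congr 2
    funext i
    cases i <;> rfl
  | app M N ihM ihN => intro ρ; simp only [rename, subst, ihM, ihN]
  | choice M N ihM ihN => intro ρ; simp only [rename, subst, ihM, ihN]

theorem rename_rename (M : Term) (ρ ρ' : ℕ → ℕ) :
    (M.rename ρ).rename ρ' = M.rename (fun i => ρ' (ρ i)) := by
  rw [rename_eq_subst _ ρ', subst_rename, rename_eq_subst]

theorem rename_subst (M : Term) : ∀ (σ : ℕ → Term) (ρ : ℕ → ℕ),
    (M.subst σ).rename ρ = M.subst (fun i => (σ i).rename ρ) := by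
  induction M with
  | var i => intro σ ρ; rfl
  | lam P ih =>
    intro σ ρ
    simp only [rename, subst, ih]
    congr 2
    funext i
    cases i with
    | zero => rfl
    | succ i => simp only [liftSub, rename_rename]; rfl
  | app M N ihM ihN => intro σ ρ; simp only [rename, subst, ihM, ihN]
  | choice M N ihM ihN => intro σ ρ; simp only [rename, subst, ihM, ihN]

theorem subst_subst (M : Term) : ∀ σ τ : ℕ → Term,
    (M.subst σ).subst τ = M.subst (fun i => (σ i).subst τ) := by
  induction M with
  | var i => intro σ τ; rfl
  | lam P ih =>
    intro σ τ
    simp only [subst, ih]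
    congr 2
    funext i
    cases i with
    | zero => rfl
    | succ i => simp only [liftSub, subst_rename, rename_subst]
  | app M N ihM ihN => intro σ τ; simp only [subst, ihM, ihN]
  | choice M N ihM ihN => intro σ τ; simp only [subst, ihM, ihN]

theorem FV_subst_of_closed (M : Term) {σ : ℕ → Term} (h : ∀ i, (σ i).FV = ∅) :
    (M.subst σ).FV = ∅ := by
  refine Set.eq_empty_of_forall_notMem fun i hi => ?_
  obtain ⟨j, -, hj⟩ := mem_FV_subst _ _ _ hi
  simp [h] at hj

end Term

theorem ClosedTerm.FV_eq (M : ClosedTerm) : M.1.FV = ∅ :=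
  Set.subset_empty_iff.1 (by simpa using M.2)

/-- A term without free variables, as a closed term. -/
def Term.toClosed (M : Term) (h : M.FV = ∅) : ClosedTerm := ⟨M, by simp [h]⟩

theorem Value.FV_apply_inst (V : Value) {N : Term} (hN : N.FV = ∅) :
    (V.body.inst N).FV = ∅ :=
  ClosedTerm.FV_eq (V.apply (N.toClosed hN))

/-- A closing substitution acts on the body of a value through the bound variable only. -/
theorem Value.body_subst (V : Value) (σ : ℕ → Term) : V.body.subst σ = V.body.inst (σ 0) := by
  refine Term.subst_congr _ fun i hi => ?_
  cases i with
  | zero => rfl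
  | succ i =>
    have : i ∈ (Term.lam V.body).FV := hi
    simp [V.closed] at this

/-! ## Mass of a set of values -/

/-- The mass that `D` gives to the set `A`. -/
noncomputable def mass {α : Type*} (D : α → ℝ≥0∞) (A : Set α) : ℝ≥0∞ := ∑' x, A.indicator D x

section mass

variable {α : Type*}

theorem mass_mono {D E : α → ℝ≥0∞} {A B : Set α} (h : D ≤ E) (hAB : A ⊆ B) :
    mass D A ≤ mass E B :=
  ENNReal.tsum_le_tsum fun x =>
    (Set.indicator_le_indicator_of_subset hAB (fun _ => zero_le) x).trans
      (Set.indicator_le_indicator (h x))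

theorem mass_le_tsum (D : α → ℝ≥0∞) (A : Set α) : mass D A ≤ ∑' x, D x :=
  ENNReal.tsum_le_tsum fun x => Set.indicator_le_self _ _ x

theorem mass_univ (D : α → ℝ≥0∞) : mass D Set.univ = ∑' x, D x := by
  simp [mass]

theorem mass_zero (A : Set α) : mass (0 : α → ℝ≥0∞) A = 0 := by
  simp [mass]

theorem mass_eq_tsum_subtype (D : α → ℝ≥0∞) (A : Set α) : mass D A = ∑' x : A, D x :=
  (tsum_subtype A D).symm

theorem le_mass {D : α → ℝ≥0∞} {A : Set α} {x : α} (hx : x ∈ A) : D x ≤ mass D A := by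
  have := ENNReal.le_tsum (f := A.indicator D) x
  rwa [Set.indicator_of_mem hx] at this

theorem mass_average (D E : α → ℝ≥0∞) (A : Set α) :
    mass (fun x => 2⁻¹ * D x + 2⁻¹ * E x) A = 2⁻¹ * mass D A + 2⁻¹ * mass E A := by
  simp only [mass, ← ENNReal.tsum_mul_left, ← ENNReal.tsum_add]
  refine tsum_congr fun x => ?_
  by_cases hx : x ∈ A <;> simp [hx]

theorem mass_bind {β : Type*} (D : β → ℝ≥0∞) (E : β → α → ℝ≥0∞) (A : Set α) :
    mass (fun x => ∑' y, D y * E y x) A = ∑' y, D y * mass (E y) A := by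
  simp only [mass, ← ENNReal.tsum_mul_left]
  rw [ENNReal.tsum_comm]
  refine tsum_congr fun x => ?_
  by_cases hx : x ∈ A <;> simp [hx]

/-- If `p A ≤ q (R A)` for every set `A`, and `f ≤ g` along the relation `R`, then the
expectation of `f` under `p` is at most the expectation of `g` under `q`. -/
theorem tsum_mul_le_tsum_mul_of_rel [Countable α] {p q f g : α → ℝ≥0∞} {R : α → α → Prop}
    (hpq : ∀ A, mass p A ≤ mass q {y | ∃ x ∈ A, R x y}) (hfg : ∀ x y, R x y → f x ≤ g y)
    (hf : ∀ x, f x ≠ ⊤) (hg : ∀ x, g x ≠ ⊤) :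
    ∑' x, p x * f x ≤ ∑' x, q x * g x := by
  -- Layer-cake formula: each `h x` is the length of the interval of levels `t ≥ 0` below it.
  have layer : ∀ r h : α → ℝ≥0∞, (∀ x, h x ≠ ⊤) →
      ∑' x, r x * h x = ∫⁻ t : ℝ in Set.Ici 0, mass r {x | t < (h x).toReal} := by
    intro r h hh
    simp only [mass]
    have hm : ∀ x, Measurable fun t : ℝ => ({x | t < (h x).toReal} : Set α).indicator r x := by
      intro x
      exact Measurable.ite measurableSet_Iio measurable_const measurable_const
    rw [MeasureTheory.lintegral_tsum fun x => (hm x).aemeasurable]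
    refine tsum_congr fun x => ?_
    have : (fun t : ℝ => ({x | t < (h x).toReal} : Set α).indicator r x)
        = (Set.Iio (h x).toReal).indicator fun _ => r x := by
      funext t
      by_cases ht : t < (h x).toReal <;> simp [ht]
    rw [this, MeasureTheory.lintegral_indicator measurableSet_Iio,
      MeasureTheory.lintegral_const, MeasureTheory.Measure.restrict_restrict measurableSet_Iio,
      MeasureTheory.Measure.restrict_apply_univ, Set.inter_comm, Set.Ici_inter_Iio,
      Real.volume_Ico, sub_zero, ENNReal.ofReal_toReal (hh x)]
  rw [layer p f hf, layer q g hg]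
  -- At each level `t`, the image under `R` of `{t < f}` lies in `{t < g}`.
  refine MeasureTheory.lintegral_mono fun t => (hpq _).trans (mass_mono le_rfl ?_)
  rintro y ⟨x, hx, hxy⟩
  exact lt_of_lt_of_le hx (ENNReal.toReal_mono (hg y) (hfg x y hxy))

end mass

/-! ## Properties of the semantics -/

theorem BigStep.le_sem {M : Term} {D : Value → ℝ≥0∞} (h : BigStep M D) : D ≤ sem M :=
  le_sSup (α := Value → ℝ≥0∞) h

theorem sem_apply (M : Term) (V : Value) : sem M V = ⨆ D : {D // BigStep M D}, D.1 V := by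
  rw [sem, sSup_apply]; rfl

theorem one_le_sem_value (V : Value) : 1 ≤ sem V.toTerm V := by
  classical
  have := BigStep.le_sem (.bv V) V
  simpa using this

theorem le_sem_choice (M N : Term) (W : Value) :
    2⁻¹ * sem M W + 2⁻¹ * sem N W ≤ sem (.choice M N) W := by
  have : Nonempty {D // BigStep M D} := ⟨⟨0, .bt M⟩⟩
  have : Nonempty {D // BigStep N D} := ⟨⟨0, .bt N⟩⟩
  rw [sem_apply M, sem_apply N, ENNReal.mul_iSup, ENNReal.mul_iSup]
  exact ENNReal.iSup_add_iSup_le fun D E => BigStep.le_sem (.bs D.2 E.2) W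

/-- Approximations of `M` and of all the continuations, chosen together, form a directed family, so
the supremum passes through finite sums. Only this lower bound on the semantics is needed. -/
theorem le_sem_app (M N : Term) (W : Value) :
    ∑' V : Value, sem M V * sem (V.body.inst N) W ≤ sem (.app M N) W := by
  let I := {D // BigStep M D} × (∀ V : Value, {E // BigStep (V.body.inst N) E})
  have key : ∀ V : Value, sem M V * sem (V.body.inst N) W ≤ ⨆ i : I, i.1.1 V * (i.2 V).1 W := by
    classical
    intro V
    rw [sem_apply M, sem_apply (V.body.inst N), ENNReal.iSup_mul]
    refine iSup_le fun D => ?_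
    rw [ENNReal.mul_iSup]
    refine iSup_le fun E => ?_
    -- Only the continuation at `V` matters for this term; elsewhere the zero approximation serves.
    let F : ∀ V : Value, {E // BigStep (V.body.inst N) E} := fun V' =>
      if h : V' = V then h ▸ E else ⟨0, .bt _⟩
    have hF : F V = E := by simp [F]
    have := le_iSup (fun i : I => i.1.1 V * (i.2 V).1 W) (D, F)
    simpa only [hF] using this
  refine (ENNReal.tsum_le_tsum key).trans ?_
  rw [ENNReal.tsum_eq_iSup_sum]
  refine iSup_le fun s => ?_
  rw [ENNReal.finsetSum_iSup fun i j => ?_]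
  · exact iSup_le fun i => (ENNReal.sum_le_tsum s).trans
      (BigStep.le_sem (.ba i.1.2 fun V _ => (i.2 V).2) W)
  · obtain ⟨F, hF, h1, h2⟩ := i.1.2.directed j.1.2
    choose G hG g1 g2 using fun V => (i.2 V).2.directed (j.2 V).2
    exact ⟨(⟨F, hF⟩, fun V => ⟨G V, hG V⟩), fun V =>
      ⟨mul_le_mul' (h1 V) (g1 V W), mul_le_mul' (h2 V) (g2 V W)⟩⟩

/-! ## Applicative similarity -/

/-- An applicative simulation, presented by its restriction to closed terms: two values are
related if all their applications are. -/
def IsSimulation (R : ClosedTerm → ClosedTerm → Prop) : Prop :=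
  ∀ M N, R M N → ∀ A : Set Value,
    mass (sem M.1) A ≤ mass (sem N.1) {W | ∃ V ∈ A, ∀ L, R (V.apply L) (W.apply L)}

/-- Applicative similarity of closed terms. -/
def Similar (M N : ClosedTerm) : Prop := ∃ R, IsSimulation R ∧ R M N

theorem Similar.refl (M : ClosedTerm) : Similar M M :=
  ⟨Eq, fun M N h A => by
    subst h
    exact mass_mono le_rfl fun V hV => ⟨V, hV, fun _ => rfl⟩, rfl⟩

theorem Similar.trans {M N L : ClosedTerm} : Similar M N → Similar N L → Similar M L := by
  rintro ⟨R, hR, hMN⟩ ⟨S, hS, hNL⟩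
  refine ⟨fun M L => ∃ N, R M N ∧ S N L, ?_, N, hMN, hNL⟩
  rintro M L ⟨N, hMN, hNL⟩ A
  refine (hR M N hMN A).trans ((hS N L hNL _).trans (mass_mono le_rfl ?_))
  rintro U ⟨W, ⟨V, hV, hVW⟩, hWU⟩
  exact ⟨V, hV, fun L => ⟨_, hVW L, hWU L⟩⟩

theorem isSimulation_similar : IsSimulation Similar := by
  rintro M N ⟨R, hR, hMN⟩ A
  refine (hR M N hMN A).trans (mass_mono le_rfl ?_)
  rintro W ⟨V, hV, h⟩
  exact ⟨V, hV, fun L => ⟨R, hR, h L⟩⟩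

/-! ### From bisimilarity to similarity -/

/-- The saturation of `A` is the disjoint union of the classes that meet `A`, and the two states
agree on each class. -/
theorem LabelledMarkovChain.IsBisimulation.probSet_saturation {S L : Type} [Countable S]
    {C : LabelledMarkovChain S L} {R : Setoid S} (hR : C.IsBisimulation R) {s t : S} (h : R s t)
    (ℓ : L) (A : Set S) :
    C.probSet s ℓ {v | ∃ u ∈ A, R u v} = C.probSet t ℓ {v | ∃ u ∈ A, R u v} := by
  have key : ∀ w, C.probSet w ℓ {v | ∃ u ∈ A, R u v}
      = ∑' E : {E : Set S | E ∈ R.classes ∧ (E ∩ A).Nonempty}, C.probSet w ℓ E.1 := by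
    intro w
    have hU : {v | ∃ u ∈ A, R u v}
        = ⋃ E ∈ {E : Set S | E ∈ R.classes ∧ (E ∩ A).Nonempty}, E := by
      ext v
      simp only [Set.mem_ofPred_eq, Set.mem_iUnion]
      constructor
      · rintro ⟨u, hu, huv⟩
        exact ⟨{x | R x u}, ⟨R.mem_classes u, u, R.refl u, hu⟩, R.symm huv⟩
      · rintro ⟨E, ⟨hE, u, huE, hu⟩, hv⟩
        exact ⟨u, hu, R.rel_iff_exists_classes.2 ⟨E, hE, huE, hv⟩⟩
    rw [LabelledMarkovChain.probSet, hU]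
    exact ENNReal.tsum_biUnion' fun E hE F hF hEF =>
      R.isPartition_classes.pairwiseDisjoint hE.1 hF.1 hEF
  rw [key s, key t]
  exact tsum_congr fun E => hR s t h ℓ E.1 E.2.1

theorem Bisimilar.similar {M N : ClosedTerm} (h : Bisimilar (Sum.inl M) (Sum.inl N)) :
    Similar M N := by
  obtain ⟨R, ⟨hR, hsort⟩, hMN⟩ := h
  refine ⟨fun M N => R (Sum.inl M) (Sum.inl N), fun M N hMN A => ?_, hMN⟩
  have hprob : ∀ (P : ClosedTerm) (B : Set Value),
      chain.probSet (Sum.inl P) (Sum.inr ()) {t | ∃ u ∈ Sum.inr '' B, R u t}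
        = mass (sem P.1) {W | ∃ V ∈ B, R (Sum.inr V) (Sum.inr W)} := by
    intro P B
    rw [LabelledMarkovChain.probSet, ← mass_eq_tsum_subtype, mass,
      Summable.tsum_sum ENNReal.summable ENNReal.summable,
      ENNReal.tsum_eq_zero.2 fun Q => ?_, zero_add, mass]
    · refine tsum_congr fun W => ?_
      simp only [Set.indicator, chain, LambdaOplus.trans, Set.mem_ofPred_eq]
      congr 1
      exact propext Set.exists_mem_image
    · simp [Set.indicator, chain, LambdaOplus.trans]
  have happ : ∀ V W : Value, R (Sum.inr V) (Sum.inr W) →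
      ∀ L, R (Sum.inl (V.apply L)) (Sum.inl (W.apply L)) := by
    intro V W hVW L
    let E : Set State := {x | R x (Sum.inl (V.apply L))}
    have hVE : Sum.inl (V.apply L) ∈ E := R.refl _
    have hE := hR _ _ hVW (Sum.inl L) E (R.mem_classes _)
    -- `V` reaches the class `E` under `L`, hence so does `W`, whose only `L`-successor is `W.apply
    -- L`.
    have hne : chain.probSet (Sum.inr W) (Sum.inl L) E ≠ 0 := by
      rw [← hE]
      intro h0
      have := ENNReal.tsum_eq_zero.1 h0 ⟨_, hVE⟩
      simp [chain, LambdaOplus.trans] at this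
    obtain ⟨⟨t, ht⟩, h0⟩ : ∃ t : E, chain.prob (Sum.inr W) (Sum.inl L) t ≠ 0 := by
      by_contra! h
      exact hne (ENNReal.tsum_eq_zero.2 h)
    rcases t with P | U
    · obtain rfl : P = W.apply L := by
        by_contra h
        simp [chain, LambdaOplus.trans, h] at h0
      exact R.symm ht
    · simp [chain, LambdaOplus.trans] at h0
  calc mass (sem M.1) A
      ≤ mass (sem M.1) {W | ∃ V ∈ A, R (Sum.inr V) (Sum.inr W)} :=
        mass_mono le_rfl fun V hV => ⟨V, hV, R.refl _⟩
    _ = mass (sem N.1) {W | ∃ V ∈ A, R (Sum.inr V) (Sum.inr W)} := by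
        rw [← hprob, ← hprob, hR.probSet_saturation hMN]
    _ ≤ _ := by
        refine mass_mono le_rfl ?_
        rintro W ⟨V, hV, hVW⟩
        exact ⟨V, hV, happ V W hVW⟩

/-! ### Open similarity -/

/-- The extension of similarity to open terms, by closing substitutions. -/
def OpenSimilar (M N : Term) : Prop :=
  ∀ σ : ℕ → Term, ∀ hσ : ∀ i, (σ i).FV = ∅,
    Similar ((M.subst σ).toClosed (M.FV_subst_of_closed hσ))
      ((N.subst σ).toClosed (N.FV_subst_of_closed hσ))

theorem OpenSimilar.refl (M : Term) : OpenSimilar M M := fun _ _ => .refl _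

theorem OpenSimilar.trans {M N L : Term} (h : OpenSimilar M N) (h' : OpenSimilar N L) :
    OpenSimilar M L := fun σ hσ => (h σ hσ).trans (h' σ hσ)

theorem OpenSimilar.subst {M N : Term} (h : OpenSimilar M N) (σ : ℕ → Term) :
    OpenSimilar (M.subst σ) (N.subst σ) := by
  intro τ hτ
  simp only [Term.subst_subst]
  exact h _ fun i => (σ i).FV_subst_of_closed hτ

theorem OpenSimilar.rename {M N : Term} (h : OpenSimilar M N) (ρ : ℕ → ℕ) :
    OpenSimilar (M.rename ρ) (N.rename ρ) := by
  simp only [Term.rename_eq_subst]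
  exact h.subst _

theorem OpenSimilar.similar {M N : ClosedTerm} (h : OpenSimilar M.1 N.1) : Similar M N := by
  have hI : (Term.lam (.var 0)).FV = ∅ := by ext i; simp [Term.FV]
  have := h (fun _ => .lam (.var 0)) fun _ => hI
  simp only [Term.subst_of_closed (ClosedTerm.FV_eq _)] at this
  exact this

theorem openSimilar_body {V W : Value} (h : ∀ L, Similar (V.apply L) (W.apply L)) :
    OpenSimilar V.body W.body := by
  intro σ hσ
  simp only [Value.body_subst]
  exact h ((σ 0).toClosed (hσ 0))

/-! ## Howe's closure -/

/-- Howe's closure of open similarity. -/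
inductive Howe : Term → Term → Prop
  | var {i : ℕ} {L : Term} : OpenSimilar (.var i) L → Howe (.var i) L
  | lam {P P' L : Term} : Howe P P' → OpenSimilar (.lam P') L → Howe (.lam P) L
  | app {M N M' N' L : Term} : Howe M M' → Howe N N' → OpenSimilar (.app M' N') L →
      Howe (.app M N) L
  | choice {M N M' N' L : Term} : Howe M M' → Howe N N' → OpenSimilar (.choice M' N') L →
      Howe (.choice M N) L

/-- Every constructor ends with an open similarity step, which absorbs another one. This stands in
for transitivity of the closure. -/
theorem Howe.trans_openSimilar {M N L : Term} (h : Howe M N) (h' : OpenSimilar N L) :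
    Howe M L := by
  cases h with
  | var h => exact .var (h.trans h')
  | lam hP h => exact .lam hP (h.trans h')
  | app hM hN h => exact .app hM hN (h.trans h')
  | choice hM hN h => exact .choice hM hN (h.trans h')

theorem Howe.refl (M : Term) : Howe M M := by
  induction M with
  | var i => exact .var (.refl _)
  | lam P ih => exact .lam ih (.refl _)
  | app M N ihM ihN => exact .app ihM ihN (.refl _)
  | choice M N ihM ihN => exact .choice ihM ihN (.refl _)

theorem OpenSimilar.howe {M N : Term} (h : OpenSimilar M N) : Howe M N :=
  (Howe.refl M).trans_openSimilar h

theorem Howe.rename {M N : Term} (h : Howe M N) :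
    ∀ ρ : ℕ → ℕ, Howe (M.rename ρ) (N.rename ρ) := by
  induction h with
  | var h => exact fun ρ => .var (h.rename ρ)
  | lam _ h ih => exact fun ρ => .lam (ih _) (h.rename ρ)
  | app _ _ h ihM ihN => exact fun ρ => .app (ihM ρ) (ihN ρ) (h.rename ρ)
  | choice _ _ h ihM ihN => exact fun ρ => .choice (ihM ρ) (ihN ρ) (h.rename ρ)

theorem Howe.subst {M N : Term} (h : Howe M N) : ∀ {σ τ : ℕ → Term}, (∀ i, Howe (σ i) (τ i)) →
    Howe (M.subst σ) (N.subst τ) := by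
  induction h with
  -- Substituting `τ` into the similarity at the variable gives a step out of `τ i`, absorbed on the
  -- right.
  | var h => exact fun hστ => (hστ _).trans_openSimilar (h.subst _)
  | lam _ h ih =>
    refine fun hστ => .lam (ih fun i => ?_) (h.subst _)
    cases i with
    | zero => exact .refl _
    | succ i => exact (hστ i).rename _
  | app _ _ h ihM ihN => exact fun hστ => .app (ihM hστ) (ihN hστ) (h.subst _)
  | choice _ _ h ihM ihN => exact fun hστ => .choice (ihM hστ) (ihN hστ) (h.subst _)

theorem Howe.inst {P Q M N : Term} (h : Howe P Q) (h' : Howe M N) :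
    Howe (P.inst M) (Q.inst N) :=
  h.subst fun i => by
    cases i with
    | zero => exact h'
    | succ i => exact .refl _

theorem Howe.fill {M N : Term} (h : Howe M N) (C : Ctx) : Howe (C.fill M) (C.fill N) := by
  induction C with
  | hole => exact h
  | lam x C ih => exact .lam (ih.rename _) (.refl _)
  | appL C L ih => exact .app ih (.refl L) (.refl _)
  | appR L C ih => exact .app (.refl L) ih (.refl _)
  | choiceL C L ih => exact .choice ih (.refl L) (.refl _)
  | choiceR L C ih => exact .choice (.refl L) ih (.refl _)

/-! ### The closure is a simulation -/

/-- Mass is monotone along a similarity, for sets of values closed under similarity. -/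
theorem mass_howe_le {M N : Term} (hM : M.FV = ∅) (hN : N.FV = ∅) (h : OpenSimilar M N)
    (A : Set Value) :
    mass (sem M) {W | ∃ V ∈ A, Howe V.body W.body}
      ≤ mass (sem N) {W | ∃ V ∈ A, Howe V.body W.body} := by
  refine (isSimulation_similar _ _ (OpenSimilar.similar (M := M.toClosed hM)
    (N := N.toClosed hN) h) _).trans (mass_mono le_rfl ?_)
  rintro U ⟨W, ⟨V, hV, hVW⟩, hWU⟩
  exact ⟨V, hV, hVW.trans_openSimilar (openSimilar_body hWU)⟩

theorem exists_closing : ∃ σ : ℕ → Term, ∀ i, (σ i).FV = ∅ :=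
  ⟨fun _ => .lam (.var 0), fun _ => by ext i; simp [Term.FV]⟩

/-- The intermediate terms in a derivation of `Howe` may have free variables even between closed
terms. This lemma and `OpenSimilar.close_left` let a closing substitution remove them. -/
theorem Howe.close_right {M N : Term} (h : Howe M N) (hM : M.FV = ∅) (σ : ℕ → Term) :
    Howe M (N.subst σ) := by
  have := h.subst (σ := σ) (τ := σ) fun i => .refl _
  rwa [Term.subst_of_closed hM] at this

theorem OpenSimilar.close_left {M N : Term} (h : OpenSimilar M N) (hN : N.FV = ∅)
    (σ : ℕ → Term) : OpenSimilar (M.subst σ) N := by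
  have := h.subst σ
  rwa [Term.subst_of_closed hN] at this

/-- Howe's closure is a simulation on closed terms. -/
theorem BigStep.mass_le_of_howe {M : Term} {D : Value → ℝ≥0∞} (h : BigStep M D) :
    ∀ {N : Term}, M.FV = ∅ → N.FV = ∅ → Howe M N → ∀ A : Set Value,
      mass D A ≤ mass (sem N) {W | ∃ V ∈ A, Howe V.body W.body} := by
  obtain ⟨σ, hσ⟩ := exists_closing
  induction h with
  | bt M => intro N _ _ _ A; simp [mass_zero]
  | bv V =>
    classical
    intro N hV hN h A
    by_cases hVA : V ∈ A
    · obtain ⟨P, hVP, hPN⟩ : ∃ P, Howe V.body P ∧ OpenSimilar (.lam P) N := by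
        cases h with
        | lam hP hL => exact ⟨_, hP, hL⟩
      have hcl : (Term.lam (P.subst (Term.liftSub σ))).FV = ∅ :=
        (Term.lam P).FV_subst_of_closed hσ
      -- The closed instance of `λP` is a value related to `V`; it carries mass 1, which similarity
      -- transports to `N`.
      let U : Value := ⟨P.subst (Term.liftSub σ), hcl⟩
      have hVU : Howe V.body U.body := by
        have h1 : Howe (V.body.subst (Term.liftSub σ)) U.body := hVP.subst fun i => .refl _
        have h2 : (Term.lam V.body).subst σ = Term.lam V.body := Term.subst_of_closed hV σ
        rwa [Term.lam.inj h2] at h1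
      have hU : U ∈ {W | ∃ V ∈ A, Howe V.body W.body} := ⟨V, hVA, hVU⟩
      calc _ ≤ _ := mass_le_tsum _ _
        _ ≤ 1 := (BigStep.bv V).tsum_le_one
        _ ≤ sem U.toTerm U := one_le_sem_value U
        _ ≤ _ := le_mass hU
        _ ≤ _ := mass_howe_le hcl hN (hPN.close_left hN σ) A
    · have : mass (Pi.single V 1) A = 0 := by
        refine ENNReal.tsum_eq_zero.2 fun W => ?_
        by_cases hW : W ∈ A
        · have : W ≠ V := fun e => hVA (e ▸ hW)
          simp [hW, this]
        · simp [hW]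
      rw [this]
      exact zero_le
  | @ba M L D E hD hE ihD ihE =>
    classical
    intro N hML hN h A
    obtain ⟨hM, hL⟩ : M.FV = ∅ ∧ L.FV = ∅ := by simpa [Term.FV] using hML
    obtain ⟨M', L', hMM', hLL', hS⟩ : ∃ M' L', Howe M M' ∧ Howe L L' ∧
        OpenSimilar (.app M' L') N := by
      cases h with
      | app h1 h2 h3 => exact ⟨_, _, h1, h2, h3⟩
    replace hS := hS.close_left hN σ
    have hcM := M'.FV_subst_of_closed hσ
    have hcL := L'.FV_subst_of_closed hσ
    replace hMM' := hMM'.close_right hM σ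
    replace hLL' := hLL'.close_right hL σ
    refine le_trans ?_ (mass_howe_le (((Term.app M' L').FV_subst_of_closed hσ)) hN hS A)
    simp only [Term.subst]
    generalize M'.subst σ = M' at *
    generalize L'.subst σ = L' at *
    set B := {W : Value | ∃ V ∈ A, Howe V.body W.body} with hB
    have hle : ∀ V : Value, mass (sem (V.body.inst L')) B ≤ 1 := fun V =>
      (mass_le_tsum _ _).trans (tsum_sem_le_one _)
    rw [mass_bind]
    calc ∑' V, D V * mass (E V) A
        -- Off the support of `D` nothing is known about `E V`, not even finiteness; its weight
        -- there is zero, so it may be replaced by 0.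
        = ∑' V, D V * (if D V = 0 then 0 else mass (E V) A) := by
          refine tsum_congr fun V => ?_
          split_ifs with hV <;> simp [hV]
      _ ≤ ∑' V, sem M' V * mass (sem (V.body.inst L')) B := by
          refine tsum_mul_le_tsum_mul_of_rel (R := fun V W => Howe V.body W.body)
            (ihD hM hcM hMM') (fun V W hVW => ?_) (fun V => ?_)
            (fun V => ne_top_of_le_ne_top ENNReal.one_ne_top (hle V))
          · split_ifs with hV
            · exact zero_le
            -- Substitutivity of the closure relates the two continuations, so their induction
            -- hypothesis applies.
            · exact ihE V hV (V.FV_apply_inst hL) (W.FV_apply_inst hcL) (hVW.inst hLL') A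
          · split_ifs with hV
            · exact ENNReal.zero_ne_top
            · exact ne_top_of_le_ne_top ENNReal.one_ne_top
                ((mass_le_tsum _ _).trans (hE V hV).tsum_le_one)
      _ = mass (fun W => ∑' V : Value, sem M' V * sem (V.body.inst L') W) B :=
          (mass_bind _ _ _).symm
      _ ≤ _ := mass_mono (le_sem_app M' L') subset_rfl
  | @bs M L D E hD hE ihD ihE =>
    intro N hML hN h A
    obtain ⟨hM, hL⟩ : M.FV = ∅ ∧ L.FV = ∅ := by simpa [Term.FV] using hML
    obtain ⟨M', L', hMM', hLL', hS⟩ : ∃ M' L', Howe M M' ∧ Howe L L' ∧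
        OpenSimilar (.choice M' L') N := by
      cases h with
      | choice h1 h2 h3 => exact ⟨_, _, h1, h2, h3⟩
    refine le_trans ?_ (mass_howe_le (((Term.choice M' L').FV_subst_of_closed hσ)) hN
      (hS.close_left hN σ) A)
    refine le_trans ?_ (mass_mono (le_sem_choice _ _) subset_rfl)
    rw [mass_average, mass_average]
    exact add_le_add
      (mul_le_mul' le_rfl (ihD hM (M'.FV_subst_of_closed hσ) (hMM'.close_right hM σ) A))
      (mul_le_mul' le_rfl (ihE hL (L'.FV_subst_of_closed hσ) (hLL'.close_right hL σ) A))

theorem Howe.tsum_sem_le {M N : Term} (h : Howe M N) (hM : M.FV = ∅) (hN : N.FV = ∅) :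
    ∑' V, sem M V ≤ ∑' V, sem N V := by
  rw [ENNReal.tsum_eq_iSup_sum]
  refine iSup_le fun s => ?_
  simp only [sem_apply M]
  rw [ENNReal.finsetSum_iSup fun D D' => ?_]
  · refine iSup_le fun D => (ENNReal.sum_le_tsum s).trans ?_
    rw [← mass_univ]
    exact (D.2.mass_le_of_howe hM hN h _).trans (mass_le_tsum _ _)
  · obtain ⟨F, hF, h1, h2⟩ := D.2.directed D'.2
    exact ⟨⟨F, hF⟩, fun V => ⟨h1 V, h2 V⟩⟩

/-! ### Contexts and the conclusion -/

theorem CtxOver.FV_fill_subset {C : Ctx} {X Y : Finset ℕ} (h : CtxOver C X Y) {M : Term}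
    (hM : M.FV ⊆ (X : Set ℕ)) : (C.fill M).FV ⊆ (Y : Set ℕ) := by
  induction h with
  | hole => exact hM
  | lam _ _ ih =>
    rw [Ctx.fill, Term.FV_abs]
    intro i hi
    have := ih hM hi.1
    simp only [Finset.coe_union, Finset.coe_singleton] at this
    exact this.resolve_right hi.2
  | appL L _ ih => exact Set.union_subset (ih hM) L.2
  | appR L _ ih => exact Set.union_subset L.2 (ih hM)
  | choiceL L _ ih => exact Set.union_subset (ih hM) L.2
  | choiceR L _ ih => exact Set.union_subset L.2 (ih hM)

theorem OpenBisimilar.symm {X : Finset ℕ} {M N : TermOver X} (h : OpenBisimilar X M N) :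
    OpenBisimilar X N M := fun σ =>
  let ⟨R, hR, hMN⟩ := h σ
  ⟨R, hR, R.symm hMN⟩

theorem OpenBisimilar.openSimilar {X : Finset ℕ} {M N : TermOver X} (h : OpenBisimilar X M N) :
    OpenSimilar M.1 N.1 := fun σ hσ =>
  (h fun i => (σ i).toClosed (hσ i)).similar

theorem OpenBisimilar.ctxPreorder {X : Finset ℕ} {M N : TermOver X} (h : OpenBisimilar X M N) :
    CtxPreorder X M N := by
  rintro C hC p rfl
  refine ⟨_, rfl, (h.openSimilar.howe.fill C).tsum_sem_le ?_ ?_⟩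
  · exact Set.subset_empty_iff.1 (by simpa using hC.FV_fill_subset M.2)
  · exact Set.subset_empty_iff.1 (by simpa using hC.FV_fill_subset N.2)

end LambdaOplus

theorem mainTheorem2 (X : Finset ℕ) (M N : LambdaOplus.TermOver X)
    (h : LambdaOplus.OpenBisimilar X M N) : LambdaOplus.CtxEquiv X M N :=
  ⟨h.ctxPreorder, h.symm.ctxPreorder⟩
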